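/- For a partition $\pi$ and a part $b$ of $\pi$, let $s(b;\pi)$ denote the number of even parts of $\pi$ that are less than $b$. For an integer $N\ge 0$, let $G(N)$ denote the number of partitions $\pi$ of $N$ into distinct parts such that no gap (difference) between consecutive parts is $\equiv 1\pmod 4$, and such that for every $k\ge 1$ the $k$-th smallest part $b$ of $\pi$ (if $\pi$ has at least $k$ parts) satisfies $b\equiv 1+2k+2s(b;\pi)\pmod 4$ if $b$ is odd, and $b\equiv 2+2k+2s(b;\pi)\pmod 4$ if $b$ is even. Let $P(N)$ denote the number of partitions of $N$ into parts $\equiv \pm 3,\pm 4\pmod{12}$ such that parts $\equiv 3\pmod 6$ are distinct (that is, each such part occurs at most once). Then $G(N)=P(N)$ for every $N\ge 0$. -/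

import Mathlib

namespace GapPartition

/-- The parts of a partition, listed in weakly increasing order. -/
def ascParts {N : ℕ} (p : N.Partition) : List ℕ := p.parts.sort (· ≤ ·)

/-- `s(b; π)`: the number of even parts of the partition that are less than `b`. -/
def evenBelow {N : ℕ} (p : N.Partition) (b : ℕ) : ℕ :=
  (p.parts.filter (fun a => Even a ∧ a < b)).card

/-- No gap between consecutive parts is congruent to `1` modulo `4`. The parts are listed in
increasing order, so the subtraction does not truncate. -/
def NoGapOneModFour {N : ℕ} (p : N.Partition) : Prop :=
  (ascParts p).IsChain (fun a b => ¬ (b - a ≡ 1 [MOD 4]))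

/-- The parity condition: the `k`-th smallest part `b` (here `k = i + 1`, as list positions start
at `0`) is `≡ 1 + 2k + 2s(b)` modulo `4` if `b` is odd, and `≡ 2 + 2k + 2s(b)` modulo `4` if `b`
is even. -/
def ParityCondition {N : ℕ} (p : N.Partition) : Prop :=
  ∀ i : Fin (ascParts p).length,
    (Odd ((ascParts p).get i) →
      (ascParts p).get i ≡
        1 + 2 * (i.val + 1) + 2 * evenBelow p ((ascParts p).get i) [MOD 4]) ∧
    (Even ((ascParts p).get i) →
      (ascParts p).get i ≡
        2 + 2 * (i.val + 1) + 2 * evenBelow p ((ascParts p).get i) [MOD 4])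

/-- All parts are `≡ ±3, ±4` modulo `12`. -/
def PartsModTwelve {N : ℕ} (p : N.Partition) : Prop :=
  ∀ a ∈ p.parts, (a : ℤ) ≡ 3 [ZMOD 12] ∨ (a : ℤ) ≡ -3 [ZMOD 12] ∨
    (a : ℤ) ≡ 4 [ZMOD 12] ∨ (a : ℤ) ≡ -4 [ZMOD 12]

/-- Parts `≡ 3` modulo `6` are distinct (each occurs at most once). -/
def DistinctThreeModSix {N : ℕ} (p : N.Partition) : Prop :=
  ∀ a ∈ p.parts, a ≡ 3 [MOD 6] → p.parts.count a ≤ 1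

open Classical in
/-- `G(N)`: the number of partitions of `N` into distinct parts such that no gap between
consecutive parts is `≡ 1 (mod 4)` and the parity condition holds. -/
noncomputable def G (N : ℕ) : ℕ :=
  (Finset.univ.filter (fun p : N.Partition =>
    p.parts.Nodup ∧ NoGapOneModFour p ∧ ParityCondition p)).card

open Classical in
/-- `P(N)`: the number of partitions of `N` into parts `≡ ±3, ±4 (mod 12)` such that parts
`≡ 3 (mod 6)` are distinct. -/
noncomputable def P (N : ℕ) : ℕ :=
  (Finset.univ.filter (fun p : N.Partition =>
    PartsModTwelve p ∧ DistinctThreeModSix p)).card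

end GapPartition

open Finset

namespace GapPartition

/-! ### Finite q-series identities by creative telescoping. -/

section Identities

variable {R : Type*} [CommRing R]

/-! In generating functions the theorem reads Σ_n q^(n²+2n) (-q;q²)_n / (q⁴;q⁴)_n = (-q³;q⁶)_∞ /
(q⁴,q⁸;q¹²)_∞.

The left side counts `G`: the parity condition is equivalent to a relation between consecutive parts
(`admissible_iff_isChain`), so partitions with n parts can be summed one part at a time
(`sum_gapLists_eq`). The right side is the usual product for `P` (`sum_P_mul_pow`).

The identity is a Bailey-pair argument. Expand 1/(q⁴;q⁴)_n as a sum over r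
(`sum_inv_pochhammer_gauss`), exchange the sums, and evaluate the sum over n by q-Chu–Vandermonde
(`sum_inv_pochhammer_chuVandermonde`). What remains is Σ_r (-1)^r q^(3r²+2r) (1 - q^(2r+1)), which
the Jacobi triple product turns into (q,q⁵,q⁶;q⁶)_∞ (`sum_inv_pochhammer_tripleProduct`). The
resulting products are compared by residues modulo 12 (`residueProd_identity`).

The identity is proved in a ring where q^M = 0, finally ℤ⟦X⟧/(X^(N+1)): its infinite sums and
products become finite, and every 1 - q^(k+1) is a unit. -/

/-- `u k` is the inverse of the `q`-Pochhammer symbol `(p; p)_k`. -/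
structure IsInvPochhammer (p : R) (u : ℕ → R) : Prop where
  zero : u 0 = 1
  succ : ∀ k, u k = u (k + 1) * (1 - p ^ (k + 1))

/-- The product `(-q; q²)_k`. -/
def oddProd (q : R) (k : ℕ) : R := ∏ i ∈ range k, (1 + q ^ (2 * i + 1))

theorem oddProd_succ (q : R) (k : ℕ) : oddProd q (k + 1) = oddProd q k * (1 + q ^ (2 * k + 1)) :=
  prod_range_succ _ _

/-- Creative telescoping: a recurrence for sums from a certificate `g`. -/
theorem mul_sum_eq_of_telescope {a b : R} {t t' g : ℕ → R} {n : ℕ}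
    (h : ∀ r d, n = r + d → a * t' r - b * t r = g (r + 1) - g r) (h0 : g 0 = 0)
    (hn : g (n + 1) = - (a * t' (n + 1))) :
    a * ∑ r ∈ range (n + 2), t' r = b * ∑ r ∈ range (n + 1), t r := by
  have h1 : ∑ r ∈ range (n + 1), (a * t' r - b * t r) = g (n + 1) - g 0 := by
    rw [← sum_range_sub]
    refine sum_congr rfl fun r hr => h r (n - r) ?_
    have := mem_range.1 hr
    omega
  rw [sum_sub_distrib, ← mul_sum, ← mul_sum, h0, hn] at h1
  rw [sum_range_succ _ (n + 1)]
  linear_combination h1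

/-- A Bailey pair relative to a = p, used later with p = q². Telescoping shows that the sum S(n)
satisfies (1 - p^(2n+2)) S(n+1) = S(n), which is the recurrence of `v`. -/
theorem sum_inv_pochhammer_gauss {p : R} {u v : ℕ → R} (hp : ∀ k, IsUnit (1 - p ^ (k + 1)))
    (hu : IsInvPochhammer p u) (hv : IsInvPochhammer (p ^ 2) v) (n : ℕ) :
    ∑ r ∈ range (n + 1), (-1) ^ r * p ^ (r ^ 2) * (1 - p ^ (2 * r + 1)) *
      u (n - r) * u (n + r + 1) = v n := by
  induction n with
  | zero =>
    have h := (hu.succ 0).symm.trans hu.zero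
    simpa [hu.zero, hv.zero, mul_comm] using h
  | succ n ih =>
    have key := mul_sum_eq_of_telescope (n := n) (a := 1 - p ^ (2 * n + 2)) (b := 1)
      (t := fun r => (-1) ^ r * p ^ (r ^ 2) * (1 - p ^ (2 * r + 1)) * u (n - r) * u (n + r + 1))
      (t' := fun r => (-1) ^ r * p ^ (r ^ 2) * (1 - p ^ (2 * r + 1)) * u (n + 1 - r) *
        u (n + 1 + r + 1))
      (g := fun r => - (-1) ^ r * p ^ (r ^ 2 - r + n + 1) * (1 - p ^ (2 * r)) * u (n + 1 - r) *
        u (n + r + 1)) ?_ ?_ ?_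
    · rw [ih, one_mul, hv.succ n, mul_comm] at key
      have : IsUnit (1 - p ^ (2 * n + 2)) := hp (2 * n + 1)
      refine this.mul_right_cancel (key.trans ?_)
      ring
    · rintro r d rfl
      have e1 : r + d - r = d := by omega
      have e2 : r + d + 1 - r = d + 1 := by omega
      have e3 : r + d + 1 - (r + 1) = d := by omega
      have e4 : (r + 1) ^ 2 - (r + 1) = r ^ 2 + r := by
        rw [show (r + 1) ^ 2 = r ^ 2 + r + (r + 1) by ring]; omega
      have e5 : r ^ 2 - r + (r + d) + 1 = r ^ 2 + d + 1 := by
        have : r ≤ r ^ 2 := Nat.le_self_pow two_ne_zero r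
        omega
      have e6 : r + d + 1 + r + 1 = 2 * r + d + 2 := by omega
      have e7 : r + d + r + 1 = 2 * r + d + 1 := by omega
      have e8 : r + d + (r + 1) + 1 = 2 * r + d + 2 := by omega
      simp only [e1, e2, e3, e4, e5, e6, e7, e8]
      rw [hu.succ d, hu.succ (2 * r + d + 1)]
      ring
    · simp
    · have e4 : (n + 1) ^ 2 - (n + 1) + n + 1 = (n + 1) ^ 2 := by
        have : n + 1 ≤ (n + 1) ^ 2 := Nat.le_self_pow two_ne_zero _
        omega
      have e5 : n + (n + 1) + 1 = 2 * n + 2 := by omega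
      have e6 : n + 1 + (n + 1) + 1 = 2 * n + 2 + 1 := by omega
      simp only [e4, e5, e6, hu.succ (2 * n + 2)]
      ring

/-- This is q-Chu–Vandermonde in base q² for ₂φ₁(q^(-2d), -q^(2r+1); q^(4r+4)), multiplied out. With
r fixed, telescoping gives a first-order recurrence in d. -/
theorem sum_inv_pochhammer_chuVandermonde {q : R} {u : ℕ → R}
    (hq : ∀ k, IsUnit (1 - q ^ (k + 1))) (hu : IsInvPochhammer (q ^ 2) u) (r d : ℕ) :
    (1 + q ^ (2 * r + 1)) * ∑ m ∈ range (d + 1), q ^ ((r + m) ^ 2 + 2 * (r + m)) *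
      oddProd q (r + m) * u (d - m) * u m * u (2 * r + m + 1) =
    oddProd q (r + d + 1) * q ^ (r ^ 2 + 2 * r) * u d * u (2 * r + d + 1) := by
  induction d with
  | zero => simp [hu.zero, oddProd_succ]; ring
  | succ d ih =>
    have key := mul_sum_eq_of_telescope (n := d)
      (a := (1 - q ^ (2 * d + 2)) * (1 - q ^ (4 * r + 2 * d + 4)))
      (b := 1 + q ^ (2 * (r + d + 1) + 1))
      (t := fun m => q ^ ((r + m) ^ 2 + 2 * (r + m)) *
        oddProd q (r + m) * u (d - m) * u m * u (2 * r + m + 1))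
      (t' := fun m => q ^ ((r + m) ^ 2 + 2 * (r + m)) *
        oddProd q (r + m) * u (d + 1 - m) * u m * u (2 * r + m + 1))
      (g := fun m => - (q ^ (2 * (d + 1 - m)) * (1 - q ^ (2 * m)) * (1 - q ^ (4 * r + 2 * m + 2)) *
        q ^ ((r + m) ^ 2 + 2 * (r + m)) *
        oddProd q (r + m) * u (d + 1 - m) * u m * u (2 * r + m + 1))) ?_ ?_ ?_
    · have hunit : IsUnit ((1 - q ^ (2 * d + 2)) * (1 - q ^ (4 * r + 2 * d + 4))) :=
        (hq (2 * d + 1)).mul (hq (4 * r + 2 * d + 3))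
      refine hunit.mul_left_cancel ?_
      rw [mul_left_comm, key, mul_left_comm, ih, ← add_assoc r d 1, oddProd_succ q (r + d + 1),
        hu.succ d, hu.succ (2 * r + d + 1), ← add_assoc (2 * r) d 1]
      ring
    · rintro m k rfl
      have e1 : m + k - m = k := by omega
      have e2 : m + k + 1 - m = k + 1 := by omega
      have e3 : m + k + 1 - (m + 1) = k := by omega
      simp only [e1, e2, e3, ← add_assoc, oddProd_succ]
      rw [hu.succ k, hu.succ m, hu.succ (2 * r + m + 1)]
      ring
    · simp
    · simp only [Nat.sub_self]
      ring

/-- The Bailey lemma at finite level L, applied to the pair of `sum_inv_pochhammer_gauss`. -/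
theorem sum_gap_finite {q : R} {u v : ℕ → R}
    (hq : ∀ k, IsUnit (1 - q ^ (k + 1))) (hu : IsInvPochhammer (q ^ 2) u)
    (hv : IsInvPochhammer (q ^ 4) v) (L : ℕ) :
    ∑ n ∈ range (L + 1), q ^ (n ^ 2 + 2 * n) * oddProd q n * v n * u (L - n) =
    oddProd q (L + 1) * ∑ r ∈ range (L + 1), (-1) ^ r * q ^ (3 * r ^ 2 + 2 * r) *
      (1 - q ^ (2 * r + 1)) * (u (L - r) * u (L + r + 1)) := by
  have hp : ∀ k, IsUnit (1 - (q ^ 2) ^ (k + 1)) := fun k => by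
    rw [← pow_mul]; exact hq (2 * k + 1)
  have hv' : IsInvPochhammer ((q ^ 2) ^ 2) v := by rwa [← pow_mul]
  calc
    _ = ∑ n ∈ range (L + 1), ∑ r ∈ range (n + 1), (-1) ^ r * q ^ (2 * r ^ 2) *
          (1 - q ^ (4 * r + 2)) * (q ^ (n ^ 2 + 2 * n) * oddProd q n * u (L - n) *
          u (n - r) * u (n + r + 1)) := by
      refine sum_congr rfl fun n _ => ?_
      rw [← sum_inv_pochhammer_gauss hp hu hv' n, mul_sum, sum_mul]
      refine sum_congr rfl fun r _ => ?_
      ring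
    _ = ∑ r ∈ range (L + 1), ∑ n ∈ Ico r (L + 1), (-1) ^ r * q ^ (2 * r ^ 2) *
          (1 - q ^ (4 * r + 2)) * (q ^ (n ^ 2 + 2 * n) * oddProd q n * u (L - n) *
          u (n - r) * u (n + r + 1)) := by
      refine sum_comm' fun n r => ?_
      simp only [mem_range, mem_Ico]
      omega
    _ = _ := by
      rw [mul_sum]
      refine sum_congr rfl fun r hr => ?_
      obtain ⟨d, rfl⟩ : ∃ d, L = r + d := ⟨L - r, by have := mem_range.1 hr; omega⟩
      have key := sum_inv_pochhammer_chuVandermonde hq hu r d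
      rw [← mul_sum, sum_Ico_eq_sum_range, show r + d + 1 - r = d + 1 by omega,
        show r + d - r = d by omega, show r + d + r + 1 = 2 * r + d + 1 by omega]
      have e : ∑ k ∈ range (d + 1), q ^ ((r + k) ^ 2 + 2 * (r + k)) * oddProd q (r + k) *
          u (r + d - (r + k)) * u (r + k - r) * u (r + k + r + 1) =
          ∑ m ∈ range (d + 1), q ^ ((r + m) ^ 2 + 2 * (r + m)) *
          oddProd q (r + m) * u (d - m) * u m * u (2 * r + m + 1) := by
        refine sum_congr rfl fun m _ => ?_
        rw [show r + d - (r + m) = d - m by omega, show r + m - r = m by omega,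
          show r + m + r + 1 = 2 * r + m + 1 by omega]
      rw [e]
      -- The Bailey pair supplies 1 - q^(4r+2) = (1 - q^(2r+1)) (1 + q^(2r+1)); the second factor is
      -- the one that the Chu–Vandermonde evaluation needs.
      linear_combination (-1) ^ r * q ^ (2 * r ^ 2) * (1 - q ^ (2 * r + 1)) * key

/-- A finite form of the Jacobi triple product for `(q, q⁵, q⁶; q⁶)_∞`. -/
theorem sum_inv_pochhammer_tripleProduct {q : R} {w : ℕ → R}
    (hq : ∀ k, IsUnit (1 - q ^ (k + 1))) (hw : IsInvPochhammer (q ^ 6) w) (n : ℕ) :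
    ∑ r ∈ range (n + 1), (-1) ^ r * q ^ (3 * r ^ 2 + 2 * r) * (1 - q ^ (2 * r + 1)) *
      (w (n - r) * w (n + r + 1)) =
    (∏ i ∈ range (n + 1), (1 - q ^ (6 * i + 1))) * (∏ i ∈ range n, (1 - q ^ (6 * i + 5))) *
      w (2 * n + 1) := by
  induction n with
  | zero => simp [hw.zero]
  | succ n ih =>
    -- The ratio b / a is the quotient of consecutive right-hand sides.
    have key := mul_sum_eq_of_telescope (n := n)
      (a := (1 - q ^ (12 * n + 12)) * (1 - q ^ (12 * n + 18)))
      (b := (1 - q ^ (6 * n + 7)) * (1 - q ^ (6 * n + 5)))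
      (t := fun r => (-1) ^ r * q ^ (3 * r ^ 2 + 2 * r) * (1 - q ^ (2 * r + 1)) *
        (w (n - r) * w (n + r + 1)))
      (t' := fun r => (-1) ^ r * q ^ (3 * r ^ 2 + 2 * r) * (1 - q ^ (2 * r + 1)) *
        (w (n + 1 - r) * w (n + 1 + r + 1)))
      (g := fun r => - (-1) ^ r * (w (n + 1 - r) * w (n + 1 + r)) *
        (q ^ (3 * r ^ 2 + 6 * n + 6 - 4 * r) * (1 - q ^ (8 * r)) * (1 - q ^ (6 * n + 7)) -
          q ^ (3 * r ^ 2 + 6 * n + 7 - 2 * r) * (1 - q ^ (4 * r)) * (1 - q ^ (6 * n + 5)))) ?_ ?_ ?_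
    · have hunit : IsUnit ((1 - q ^ (12 * n + 12)) * (1 - q ^ (12 * n + 18))) :=
        (hq (12 * n + 11)).mul (hq (12 * n + 17))
      refine hunit.mul_left_cancel ?_
      simp only [prod_range_succ] at ih ⊢
      rw [key, ih, hw.succ (2 * n + 1),
        hw.succ (2 * n + 1 + 1), show 2 * (n + 1) + 1 = 2 * n + 1 + 1 + 1 by ring]
      ring
    · rintro r d rfl
      have e1 : r + d - r = d := by omega
      have e2 : r + d + 1 - r = d + 1 := by omega
      have e3 : r + d + 1 - (r + 1) = d := by omega
      have e4 : 3 * (r + 1) ^ 2 + 6 * (r + d) + 6 - 4 * (r + 1) = 3 * r ^ 2 + 8 * r + 6 * d + 5 := by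
        rw [show (r + 1) ^ 2 = r ^ 2 + 2 * r + 1 by ring]; omega
      have e5 : 3 * (r + 1) ^ 2 + 6 * (r + d) + 7 - 2 * (r + 1) =
          3 * r ^ 2 + 10 * r + 6 * d + 8 := by
        rw [show (r + 1) ^ 2 = r ^ 2 + 2 * r + 1 by ring]; omega
      have e6 : 3 * r ^ 2 + 6 * (r + d) + 6 - 4 * r = 3 * r ^ 2 + 2 * r + 6 * d + 6 := by omega
      have e7 : 3 * r ^ 2 + 6 * (r + d) + 7 - 2 * r = 3 * r ^ 2 + 4 * r + 6 * d + 7 := by omega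
      have e9 : r + d + r + 1 = 2 * r + d + 1 := by omega
      have e10 : r + d + 1 + (r + 1) = 2 * r + d + 2 := by omega
      have e11 : r + d + 1 + r = 2 * r + d + 1 := by omega
      simp only [e1, e2, e3, e4, e5, e6, e7, e9, e10, e11]
      rw [hw.succ d, hw.succ (2 * r + d + 1)]
      ring
    · simp
    · have e4 : 3 * (n + 1) ^ 2 + 6 * n + 6 - 4 * (n + 1) = 3 * n ^ 2 + 8 * n + 5 := by
        rw [show (n + 1) ^ 2 = n ^ 2 + 2 * n + 1 by ring]; omega
      have e5 : 3 * (n + 1) ^ 2 + 6 * n + 7 - 2 * (n + 1) = 3 * n ^ 2 + 10 * n + 8 := by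
        rw [show (n + 1) ^ 2 = n ^ 2 + 2 * n + 1 by ring]; omega
      have e6 : n + 1 + (n + 1) = 2 * n + 2 := by omega
      simp only [e4, e5, e6, hw.succ (2 * n + 2)]
      ring

/-! ### Passage to the limit: nilpotent q and products over residue classes. -/

theorem isUnit_one_sub_pow {q : R} {M : ℕ} (hM : q ^ M = 0) (k : ℕ) :
    IsUnit (1 - q ^ (k + 1)) :=
  IsNilpotent.isUnit_one_sub ⟨M, by rw [← pow_mul, mul_comm, pow_mul, hM, zero_pow k.succ_ne_zero]⟩

theorem pow_eq_zero_of_ge {q : R} {M : ℕ} (hM : q ^ M = 0) {k : ℕ} (hk : M ≤ k) : q ^ k = 0 :=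
  pow_eq_zero_of_le hk hM

theorem exists_isInvPochhammer {q : R} {M : ℕ} (hM : q ^ M = 0) {c : ℕ} (hc : 0 < c) :
    ∃ u, IsInvPochhammer (q ^ c) u := by
  refine ⟨fun k => ∏ i ∈ range k, Ring.inverse (1 - (q ^ c) ^ (i + 1)), by simp, fun k => ?_⟩
  have hM' : (q ^ c) ^ M = 0 := by rw [← pow_mul, mul_comm, pow_mul, hM, zero_pow hc.ne']
  rw [prod_range_succ, mul_assoc, Ring.inverse_mul_cancel _ (isUnit_one_sub_pow hM' k), mul_one]

theorem IsInvPochhammer.mul_prod {p : R} {u : ℕ → R} (hu : IsInvPochhammer p u) (k : ℕ) :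
    u k * ∏ i ∈ range k, (1 - p ^ (i + 1)) = 1 := by
  induction k with
  | zero => simp [hu.zero]
  | succ k ih =>
    rw [hu.succ k] at ih
    rw [prod_range_succ]
    linear_combination ih

theorem IsInvPochhammer.eq_of_ge {p : R} {u : ℕ → R} (hu : IsInvPochhammer p u) {M : ℕ}
    (hM : p ^ M = 0) {k : ℕ} (hk : M ≤ k) : u k = u M := by
  induction k, hk using Nat.le_induction with
  | base => rfl
  | succ k hk ih => rw [← ih, hu.succ k, pow_eq_zero_of_ge hM (by omega), sub_zero, mul_one]

/-- The product of `1 - q ^ i` over `0 < i ≤ M` with `i ≡ a` modulo `m`. -/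
def residueProd (q : R) (M m a : ℕ) : R :=
  ∏ i ∈ range M, if (i + 1) % m = a % m then 1 - q ^ (i + 1) else 1

theorem prod_arithProg_eq {g : ℕ → R} {M K m a : ℕ} (hg : ∀ i, M ≤ i → g i = 1) (hK : M ≤ K)
    (ha : 0 < a) (ham : a ≤ m) :
    ∏ k ∈ range K, g (m * k + a) =
      ∏ i ∈ range M, if (i + 1) % m = a % m then g (i + 1) else 1 := by
  have hsub : range M ⊆ range (m * K) :=
    range_subset_range.2 (hK.trans (Nat.le_mul_of_pos_left K (by omega)))
  rw [prod_subset hsub fun i _ hi => ?_, ← prod_filter]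
  · refine prod_nbij (fun k => m * k + a - 1) (fun k hk => ?_) (fun k _ l _ h => ?_)
      (fun i hi => ?_) (fun k _ => ?_)
    · simp only [mem_filter, mem_range] at hk ⊢
      have h1 : m * (k + 1) ≤ m * K := Nat.mul_le_mul_left m hk
      rw [mul_add, mul_one] at h1
      refine ⟨by omega, ?_⟩
      rw [show m * k + a - 1 + 1 = a + m * k by omega, Nat.add_mul_mod_self_left]
    · have h2 : m * k = m * l := by
        change m * k + a - 1 = m * l + a - 1 at h
        omega
      exact Nat.eq_of_mul_eq_mul_left (by omega) h2
    · simp only [coe_filter, mem_range, Set.mem_ofPred_eq] at hi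
      have hmod : a ≡ i + 1 [MOD m] := hi.2.symm
      have hai : a ≤ i + 1 := by
        rcases ham.lt_or_eq with h | rfl
        · have := Nat.mod_le (i + 1) m
          rw [hi.2, Nat.mod_eq_of_lt h] at this
          exact this
        · rw [Nat.mod_self] at hi
          exact Nat.le_of_dvd (by omega) (Nat.dvd_of_mod_eq_zero hi.2)
      obtain ⟨k, hk⟩ := (Nat.modEq_iff_dvd' hai).1 hmod
      refine ⟨k, ?_, ?_⟩
      · simp only [coe_range, Set.mem_Iio]
        by_contra hcon
        have := Nat.mul_le_mul_left m (not_lt.1 hcon)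
        omega
      · change m * k + a - 1 = i
        omega
    · rw [show m * k + a - 1 + 1 = m * k + a by omega]
  · rw [hg _ (by have := mt mem_range.2 hi; omega), ite_self]

theorem prod_arithProg_eq_residueProd {q : R} {M : ℕ} (hM : q ^ M = 0) {K m a : ℕ} (hK : M ≤ K)
    (ha : 0 < a) (ham : a ≤ m) :
    ∏ k ∈ range K, (1 - q ^ (m * k + a)) = residueProd q M m a :=
  prod_arithProg_eq (g := fun i => 1 - q ^ i)
    (fun i hi => by simp [pow_eq_zero_of_ge hM hi]) hK ha ham

theorem isUnit_residueProd {q : R} {M : ℕ} (hM : q ^ M = 0) (m a : ℕ) :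
    IsUnit (residueProd q M m a) := by
  refine IsUnit.prod_iff.2 fun i _ => ?_
  split_ifs
  · exact isUnit_one_sub_pow hM i
  · exact isUnit_one

/-- Holds factor by factor: which products contain 1 - q^(i+1) depends only on i + 1 modulo 12. -/
theorem residueProd_identity (q : R) (M : ℕ) :
    residueProd q M 4 2 * residueProd q M 6 1 * residueProd q M 6 5 * residueProd q M 6 6 *
      (residueProd q M 12 4 * residueProd q M 12 8) * residueProd q M 6 3 =
    residueProd q M 12 6 * residueProd q M 2 1 * residueProd q M 2 2 := by
  simp only [residueProd, ← prod_mul_distrib]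
  refine prod_congr rfl fun i _ => ?_
  have h2 : (i + 1) % 2 = (i + 1) % 12 % 2 := by omega
  have h4 : (i + 1) % 4 = (i + 1) % 12 % 4 := by omega
  have h6 : (i + 1) % 6 = (i + 1) % 12 % 6 := by omega
  have hlt : (i + 1) % 12 < 12 := Nat.mod_lt _ (by norm_num)
  rw [h2, h4, h6]
  generalize 1 - q ^ (i + 1) = x
  generalize (i + 1) % 12 = r at hlt ⊢
  interval_cases r <;> simp

/-- The analytic identity behind the theorem, modulo `q ^ M`. -/
theorem sum_gap_mul_eq_prod {q : R} {M : ℕ} (hM : q ^ M = 0) {v : ℕ → R}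
    (hv : IsInvPochhammer (q ^ 4) v) :
    (∑ n ∈ range M, q ^ (n ^ 2 + 2 * n) * oddProd q n * v n) *
      (residueProd q M 12 4 * residueProd q M 12 8) =
    ∏ i ∈ range M, if (i + 1) % 6 = 3 % 6 then 1 + q ^ (i + 1) else 1 := by
  obtain ⟨u, hu⟩ := exists_isInvPochhammer hM (c := 2) two_pos
  obtain ⟨w, hw⟩ := exists_isInvPochhammer hM (c := 6) (by norm_num)
  have hpow (c : ℕ) (hc : 0 < c) : (q ^ c) ^ M = 0 := by
    rw [← pow_mul, mul_comm, pow_mul, hM, zero_pow hc.ne']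
  have hunit := isUnit_one_sub_pow hM
  have trunc (f : ℕ → R) (hf : ∀ n, M ≤ n → f n = 0) :
      ∑ n ∈ range (2 * M + 1), f n = ∑ n ∈ range M, f n :=
    (sum_subset (range_subset_range.2 (by omega)) fun n _ hn =>
      hf n (not_lt.1 (mt mem_range.2 hn))).symm
  -- Terms with index at least M vanish. For r < M, level 2M keeps 2M - r above M, where the inverse
  -- Pochhammer symbols are constant.
  have hF := sum_gap_finite hunit hu hv (2 * M)
  have hD := sum_inv_pochhammer_tripleProduct hunit hw (2 * M)
  rw [trunc _ fun n hn => ?_, trunc _ fun n hn => ?_] at hF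
  rotate_left
  · rw [pow_eq_zero_of_ge hM (by nlinarith)]; simp
  · rw [pow_eq_zero_of_ge hM (by nlinarith)]; simp
  rw [trunc _ fun n hn => ?_] at hD
  rotate_left
  · rw [pow_eq_zero_of_ge hM (by nlinarith)]; simp
  set S := ∑ r ∈ range M, (-1) ^ r * q ^ (3 * r ^ 2 + 2 * r) * (1 - q ^ (2 * r + 1)) with hS
  have stable {c : ℕ} (hc : 0 < c) {x : ℕ → R} (hx : IsInvPochhammer (q ^ c) x) :
      ∑ r ∈ range M, (-1) ^ r * q ^ (3 * r ^ 2 + 2 * r) * (1 - q ^ (2 * r + 1)) *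
        (x (2 * M - r) * x (2 * M + r + 1)) = S * (x M * x M) := by
    rw [hS, sum_mul]
    refine sum_congr rfl fun r hr => ?_
    have := mem_range.1 hr
    rw [hx.eq_of_ge (hpow c hc) (k := 2 * M - r) (by omega),
      hx.eq_of_ge (hpow c hc) (k := 2 * M + r + 1) (by omega)]
  rw [stable two_pos hu] at hF
  rw [stable (by norm_num) hw, hw.eq_of_ge (hpow 6 (by norm_num)) (k := 2 * (2 * M) + 1) (by omega),
    prod_arithProg_eq_residueProd hM (by omega) (by norm_num) (by norm_num),
    prod_arithProg_eq_residueProd hM (by omega) (by norm_num) (by norm_num)] at hD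
  have hL : ∑ n ∈ range M, q ^ (n ^ 2 + 2 * n) * oddProd q n * v n * u (2 * M - n) =
      (∑ n ∈ range M, q ^ (n ^ 2 + 2 * n) * oddProd q n * v n) * u M := by
    rw [sum_mul]
    refine sum_congr rfl fun n hn => ?_
    have := mem_range.1 hn
    rw [hu.eq_of_ge (hpow 2 two_pos) (k := 2 * M - n) (by omega)]
  rw [hL] at hF
  have hU : u M * residueProd q M 2 2 = 1 := by
    rw [← prod_arithProg_eq_residueProd hM le_rfl two_pos le_rfl]
    refine Eq.trans ?_ (hu.mul_prod M)
    congr 1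
    exact prod_congr rfl fun i _ => by ring
  have hW : w M * residueProd q M 6 6 = 1 := by
    rw [← prod_arithProg_eq_residueProd hM le_rfl (by norm_num) le_rfl]
    refine Eq.trans ?_ (hw.mul_prod M)
    congr 1
    exact prod_congr rfl fun i _ => by ring
  have hO : oddProd q (2 * M + 1) * residueProd q M 2 1 = residueProd q M 4 2 := by
    rw [← prod_arithProg_eq_residueProd hM (K := 2 * M + 1) (by omega) one_pos one_le_two,
      ← prod_arithProg_eq_residueProd hM (K := 2 * M + 1) (by omega) two_pos (by norm_num),
      oddProd, ← prod_mul_distrib]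
    exact prod_congr rfl fun i _ => by ring
  have hT : (∏ i ∈ range M, if (i + 1) % 6 = 3 % 6 then 1 + q ^ (i + 1) else 1) *
      residueProd q M 6 3 = residueProd q M 12 6 := by
    rw [← prod_arithProg_eq (g := fun i => 1 + q ^ i) (K := M) (by
        intro i hi; simp [pow_eq_zero_of_ge hM hi]) le_rfl (by norm_num) (by norm_num),
      ← prod_arithProg_eq_residueProd hM le_rfl (by norm_num) (by norm_num),
      ← prod_arithProg_eq_residueProd hM le_rfl (by norm_num) (by norm_num), ← prod_mul_distrib]
    exact prod_congr rfl fun i _ => by ring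
  have hid := residueProd_identity q M
  refine ((isUnit_residueProd hM 6 3).mul
    ((isUnit_residueProd hM 2 1).mul (isUnit_residueProd hM 2 2))).mul_right_cancel ?_
  generalize (∏ i ∈ range M, if (i + 1) % 6 = 3 % 6 then 1 + q ^ (i + 1) else 1) = T at *
  generalize (∑ n ∈ range M, q ^ (n ^ 2 + 2 * n) * oddProd q n * v n) = Φ at *
  generalize residueProd q M 2 2 = Q22 at *
  generalize residueProd q M 6 6 = Q66 at *
  generalize residueProd q M 2 1 = Q21 at *
  generalize residueProd q M 6 3 = Q63 at *
  generalize residueProd q M 12 4 = Q4 at *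
  generalize residueProd q M 12 8 = Q8 at *
  generalize residueProd q M 6 1 = Q61 at *
  generalize residueProd q M 6 5 = Q65 at *
  have hS' : S = Q61 * Q65 * Q66 := by
    linear_combination Q66 ^ 2 * hD + (Q61 * Q65 * Q66 - S * (w M * Q66 + 1)) * hW
  have hΦ : Φ * Q22 = oddProd q (2 * M + 1) * S := by
    linear_combination Q22 ^ 2 * hF +
      (oddProd q (2 * M + 1) * S * (u M * Q22 + 1) - Φ * Q22) * hU
  rw [hS'] at hΦ
  linear_combination Q21 * Q63 * (Q4 * Q8) * hΦ + Q61 * Q65 * Q66 * Q63 * (Q4 * Q8) * hO + hid -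
    Q21 * Q22 * hT

end Identities

/-! ### Admissible partitions as chains, and the generating function of `G`. -/

section Chains

/-- The relation between consecutive parts of an admissible partition, where an empty partition
is thought of as ending in a part `0`. -/
def GapRel (a b : ℕ) : Prop := a < b ∧ b % 4 = (a + (2 - a % 2) + (2 - b % 2)) % 4

instance : DecidableRel GapRel := fun _ _ => inferInstanceAs (Decidable (_ ∧ _))

theorem isChain_lt_of_isChain_gapRel {l : List ℕ} (h : l.IsChain GapRel) : l.Pairwise (· < ·) :=
  List.isChain_iff_pairwise.1 (h.imp fun _ _ h => h.1)

/-- The parity condition on a list of parts that is preceded by parts for which the number of parts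
plus the number of even parts is `t`. -/
def ParityFrom : ℕ → List ℕ → Prop
  | _, [] => True
  | t, b :: l => (Odd b → b % 4 = (3 + 2 * t) % 4) ∧ (Even b → b % 4 = (2 * t) % 4) ∧
      ParityFrom (t + 1 + if Even b then 1 else 0) l

theorem parityFrom_iff_forall {l : List ℕ} (hl : l.Pairwise (· < ·)) (t : ℕ) :
    ParityFrom t l ↔ ∀ i : Fin l.length,
      (Odd (l.get i) → l.get i ≡
        1 + 2 * (i.val + 1) + 2 * l.countP (fun a => Even a ∧ a < l.get i) + 2 * t [MOD 4]) ∧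
      (Even (l.get i) → l.get i ≡
        2 + 2 * (i.val + 1) + 2 * l.countP (fun a => Even a ∧ a < l.get i) + 2 * t [MOD 4]) := by
  induction l generalizing t with
  | nil => simp [ParityFrom]
  | cons b l ih =>
    obtain ⟨hb, hl⟩ := List.pairwise_cons.1 hl
    rw [ParityFrom, ih hl, ← and_assoc]
    refine Iff.trans ?_ (Fin.forall_fin_succ (n := l.length)).symm
    have h0 : (b :: l).countP (fun a => Even a ∧ a < b) = 0 := by
      rw [List.countP_eq_zero]
      intro a ha
      rcases List.mem_cons.1 ha with rfl | ha
      · simp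
      · have := hb a ha
        simp [this.le]
    refine and_congr ?_ (forall_congr' fun i => ?_)
    · change _ ↔ (Odd b → b ≡
          1 + 2 * (0 + 1) + 2 * (b :: l).countP (fun a => Even a ∧ a < b) + 2 * t [MOD 4]) ∧
        (Even b → b ≡
          2 + 2 * (0 + 1) + 2 * (b :: l).countP (fun a => Even a ∧ a < b) + 2 * t [MOD 4])
      simp only [h0, Nat.ModEq]
      refine and_congr (imp_congr_right fun _ => ?_) (imp_congr_right fun _ => ?_) <;> omega
    · have hc : (b :: l).countP (fun a => Even a ∧ a < l.get i) =
          l.countP (fun a => Even a ∧ a < l.get i) + if Even b then 1 else 0 := by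
        rw [List.countP_cons]
        have := hb _ (List.get_mem l i)
        simp only [this, and_true, decide_eq_true_eq]
      change _ ↔ (Odd (l.get i) → l.get i ≡ 1 + 2 * (i.val + 1 + 1) +
          2 * (b :: l).countP (fun a => Even a ∧ a < l.get i) + 2 * t [MOD 4]) ∧
        (Even (l.get i) → l.get i ≡ 2 + 2 * (i.val + 1 + 1) +
          2 * (b :: l).countP (fun a => Even a ∧ a < l.get i) + 2 * t [MOD 4])
      simp only [hc, Nat.ModEq]
      refine and_congr (imp_congr_right fun _ => ?_) (imp_congr_right fun _ => ?_) <;> omega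

/-- The counter `t` matters only modulo 2, and the last part a determines it through a ≡ 2t + (a mod
2) modulo 4. This invariant passes to the next part. -/
theorem parityFrom_iff_isChain {a : ℕ} {l : List ℕ} (hl : (a :: l).Pairwise (· < ·)) {t : ℕ}
    (ht : a % 4 = (2 * t + a % 2) % 4) : ParityFrom t l ↔ (a :: l).IsChain GapRel := by
  induction l generalizing a t with
  | nil => simp [ParityFrom]
  | cons b l ih =>
    obtain ⟨ha, hl⟩ := List.pairwise_cons.1 hl
    have hab := ha b List.mem_cons_self
    rw [ParityFrom, List.isChain_cons_cons, GapRel, ← and_assoc]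
    have hiff : ((Odd b → b % 4 = (3 + 2 * t) % 4) ∧ (Even b → b % 4 = (2 * t) % 4)) ↔
        (a < b ∧ b % 4 = (a + (2 - a % 2) + (2 - b % 2)) % 4) := by
      rw [Nat.odd_iff, Nat.even_iff]
      omega
    rw [hiff]
    refine and_congr_right fun h => ih hl ?_
    simp only [Nat.even_iff]
    split_ifs <;> omega

variable {N : ℕ}

theorem coe_ascParts (p : N.Partition) : (ascParts p : Multiset ℕ) = p.parts :=
  Multiset.sort_eq _ _

theorem evenBelow_eq_countP (p : N.Partition) (b : ℕ) :
    evenBelow p b = (ascParts p).countP (fun a => Even a ∧ a < b) := by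
  rw [evenBelow, ← Multiset.countP_eq_card_filter, ← coe_ascParts, Multiset.coe_countP]

theorem parityCondition_iff (p : N.Partition) (hp : (ascParts p).Pairwise (· < ·)) :
    ParityCondition p ↔ ParityFrom 0 (ascParts p) := by
  rw [parityFrom_iff_forall hp, ParityCondition]
  simp only [evenBelow_eq_countP, mul_zero, add_zero]

theorem nodup_iff_pairwise_ascParts (p : N.Partition) :
    p.parts.Nodup ↔ (ascParts p).Pairwise (· < ·) := by
  rw [← coe_ascParts, Multiset.coe_nodup]
  refine ⟨fun h => ?_, fun h => h.imp fun h => h.ne⟩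
  have hs : (ascParts p).Pairwise (· ≤ ·) := Multiset.pairwise_sort _ _
  exact (hs.and h).imp fun h => lt_of_le_of_ne h.1 h.2

theorem admissible_iff_isChain (p : N.Partition) :
    (p.parts.Nodup ∧ NoGapOneModFour p ∧ ParityCondition p) ↔
      (0 :: ascParts p).IsChain GapRel := by
  have hpos : ∀ a ∈ ascParts p, 0 < a := fun a ha =>
    p.parts_pos (by rwa [← coe_ascParts, Multiset.mem_coe])
  constructor
  · rintro ⟨h1, -, h3⟩
    rw [nodup_iff_pairwise_ascParts] at h1
    rw [parityCondition_iff p h1] at h3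
    exact (parityFrom_iff_isChain (List.pairwise_cons.2 ⟨hpos, h1⟩) rfl).1 h3
  · intro h
    have hlt := isChain_lt_of_isChain_gapRel h
    have hlt' := (List.pairwise_cons.1 hlt).2
    refine ⟨(nodup_iff_pairwise_ascParts p).2 hlt', ?_, ?_⟩
    -- `GapRel` forces b - a ≡ 0, 2 or 3 modulo 4, according to the parities of a and b.
    · refine h.tail.imp fun a b hab => ?_
      obtain ⟨h1, h2⟩ := hab
      rw [Nat.ModEq]
      omega
    · rw [parityCondition_iff p hlt']
      exact (parityFrom_iff_isChain hlt rfl).2 h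

/-- The lists `l` of length `n` with entries less than `M` for which `b :: l` is a chain. -/
def gapLists (M : ℕ) : ℕ → ℕ → Finset (List ℕ)
  | 0, _ => {[]}
  | n + 1, b => ((range M).filter (GapRel b)).biUnion fun c => (gapLists M n c).image (c :: ·)

theorem mem_gapLists {M n b : ℕ} {l : List ℕ} :
    l ∈ gapLists M n b ↔ l.length = n ∧ (b :: l).IsChain GapRel ∧ ∀ x ∈ l, x < M := by
  induction n generalizing b l with
  | zero =>
    rw [gapLists, mem_singleton, List.length_eq_zero_iff]
    exact ⟨by rintro rfl; simp, fun h => h.1⟩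
  | succ n ih =>
    simp only [gapLists, mem_biUnion, mem_filter, mem_range, mem_image, ih]
    constructor
    · rintro ⟨c, ⟨h1, h2⟩, l, ⟨rfl, h3, h4⟩, rfl⟩
      exact ⟨rfl, List.isChain_cons_cons.2 ⟨h2, h3⟩, List.forall_mem_cons.2 ⟨h1, h4⟩⟩
    · rintro ⟨h1, h2, h3⟩
      cases l with
      | nil => simp at h1
      | cons c l =>
        rw [List.isChain_cons_cons] at h2
        rw [List.forall_mem_cons] at h3
        exact ⟨c, ⟨h3.1, h2.1⟩, l, ⟨by simpa using h1, h2.2, h3.2⟩, rfl⟩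

variable {R : Type*} [CommRing R]

theorem sum_gapLists_succ (q : R) (M n b : ℕ) :
    ∑ l ∈ gapLists M (n + 1) b, q ^ l.sum =
      ∑ c ∈ (range M).filter (GapRel b), q ^ c * ∑ l ∈ gapLists M n c, q ^ l.sum := by
  rw [gapLists, sum_biUnion]
  · refine sum_congr rfl fun c _ => ?_
    rw [sum_image (by simp), mul_sum]
    exact sum_congr rfl fun l _ => by rw [List.sum_cons, pow_add]
  · intro c _ d _ hcd
    rw [Function.onFun, disjoint_left]
    intro l hl hl'
    obtain ⟨_, _, rfl⟩ := mem_image.1 hl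
    obtain ⟨_, _, h⟩ := mem_image.1 hl'
    exact hcd (List.cons.inj h).1.symm

/-- Splitting off the two smallest possible successors of `b`. -/
theorem sum_filter_gapRel {f : ℕ → R} {M : ℕ} (hf : ∀ i, M ≤ i → f i = 0) (b : ℕ) :
    ∑ c ∈ (range M).filter (GapRel b), f c =
      f (b + 3) + f (b + 4 - 2 * (b % 2)) + ∑ c ∈ (range M).filter (GapRel (b + 4)), f c := by
  have extend (P : ℕ → Prop) [DecidablePred P] : ∑ c ∈ (range M).filter P, f c =
      ∑ c ∈ (range (M + b + 5)).filter P, f c := by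
    refine sum_subset (filter_subset_filter _ (range_subset_range.2 (by omega))) fun c h1 h2 => ?_
    simp only [mem_filter, mem_range] at h1 h2
    exact hf c (not_lt.1 fun h => h2 ⟨h, h1.2⟩)
  rw [extend, extend]
  have hset : (range (M + b + 5)).filter (GapRel b) = insert (b + 3)
      (insert (b + 4 - 2 * (b % 2)) ((range (M + b + 5)).filter (GapRel (b + 4)))) := by
    ext c
    simp only [mem_filter, mem_range, mem_insert, GapRel]
    omega
  rw [hset, sum_insert, sum_insert]
  · exact (add_assoc _ _ _).symm
  all_goals
    simp only [mem_filter, mem_insert, GapRel]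
    omega

/-- Shifting b by 4 multiplies the sum for n + 1 parts by q^(4(n+1)), so splitting off the two
smallest successors yields the factor 1/(1 - q^(4(n+1))). The exponent b + 1 - b % 2 is the least
odd number that is at least b. -/
theorem sum_gapLists_eq {q : R} {M : ℕ} (hM : q ^ M = 0) {v : ℕ → R}
    (hv : IsInvPochhammer (q ^ 4) v) (n b : ℕ) :
    ∑ l ∈ gapLists M n b, q ^ l.sum =
      q ^ (n * (b + 1 - b % 2)) * (q ^ (n ^ 2 + n) * oddProd q n * v n) := by
  induction n generalizing b with
  | zero => simp [gapLists, oddProd, hv.zero]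
  | succ n ih =>
    rw [sum_gapLists_succ]
    simp only [ih]
    -- Descending induction on b, as k ≥ M - b grows; for b ≥ M both sides vanish.
    have step (k : ℕ) : ∀ b, M ≤ b + k → ∑ c ∈ (range M).filter (GapRel b),
        q ^ c * (q ^ (n * (c + 1 - c % 2)) * (q ^ (n ^ 2 + n) * oddProd q n * v n)) =
        q ^ ((n + 1) * (b + 1 - b % 2)) *
          (q ^ ((n + 1) ^ 2 + (n + 1)) * oddProd q (n + 1) * v (n + 1)) := by
      induction k with
      | zero =>
        intro b hb
        rw [pow_eq_zero_of_ge hM (k := (n + 1) * (b + 1 - b % 2)), zero_mul, sum_eq_zero]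
        · intro c hc
          simp only [mem_filter, mem_range, GapRel] at hc
          omega
        · exact le_trans (by omega) (Nat.le_mul_of_pos_left _ n.succ_pos)
      | succ k ihk =>
        intro b hb
        rw [sum_filter_gapRel fun c hc => by rw [pow_eq_zero_of_ge hM hc, zero_mul],
          ihk (b + 4) (by omega), oddProd_succ, hv.succ n]
        -- In both parities the two split-off terms differ by the factor q^(2n+1), which produces 1
        -- + q^(2n+1).
        rcases Nat.even_or_odd' b with ⟨c, rfl | rfl⟩
        · rw [show 2 * c + 4 - 2 * (2 * c % 2) = 2 * c + 4 by omega,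
            show 2 * c + 4 + 1 - (2 * c + 4) % 2 = 2 * c + 5 by omega,
            show 2 * c + 3 + 1 - (2 * c + 3) % 2 = 2 * c + 3 by omega,
            show 2 * c + 1 - 2 * c % 2 = 2 * c + 1 by omega]
          ring
        · rw [show 2 * c + 1 + 4 - 2 * ((2 * c + 1) % 2) = 2 * c + 3 by omega,
            show 2 * c + 1 + 4 + 1 - (2 * c + 1 + 4) % 2 = 2 * c + 5 by omega,
            show 2 * c + 1 + 3 + 1 - (2 * c + 1 + 3) % 2 = 2 * c + 5 by omega,
            show 2 * c + 3 + 1 - (2 * c + 3) % 2 = 2 * c + 3 by omega,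
            show 2 * c + 1 + 1 - (2 * c + 1) % 2 = 2 * c + 1 by omega]
          ring
    exact step M b (by omega)

theorem G_eq_card_gapLists {M : ℕ} (hN : N < M) :
    G N = (((range M).biUnion fun n => gapLists M n 0).filter (·.sum = N)).card := by
  classical
  refine card_bij (fun p _ => ascParts p) (fun p hp => ?_) (fun p _ p' _ h => ?_) fun l hl => ?_
  · have hch := (admissible_iff_isChain p).1 (mem_filter.1 hp).2
    have hsum : (ascParts p).sum = N := by
      rw [← Multiset.sum_coe, coe_ascParts, p.parts_sum]
    have hpos : ∀ a ∈ ascParts p, 1 ≤ a := fun a ha =>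
      p.parts_pos (by rwa [← coe_ascParts, Multiset.mem_coe])
    have hlen := List.length_le_sum_of_one_le _ hpos
    simp only [mem_filter, mem_biUnion, mem_range, mem_gapLists]
    refine ⟨⟨_, by omega, rfl, hch, fun x hx => ?_⟩, hsum⟩
    have := List.le_sum_of_mem hx
    omega
  · ext1
    rw [← coe_ascParts, ← coe_ascParts]
    exact congrArg _ h
  · simp only [mem_filter, mem_biUnion, mem_range, mem_gapLists] at hl
    obtain ⟨⟨n, _, _, hch, _⟩, hsum⟩ := hl
    have hlt := List.pairwise_cons.1 (isChain_lt_of_isChain_gapRel hch)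
    let p : N.Partition := ⟨l, fun {i} hi => hlt.1 i hi, by rw [Multiset.sum_coe, hsum]⟩
    have hp : ascParts p = l := by
      refine List.Perm.eq_of_pairwise' (r := (· ≤ ·)) (Multiset.pairwise_sort _ _)
        (hlt.2.imp le_of_lt) ?_
      rw [← Multiset.coe_eq_coe]
      exact coe_ascParts p
    exact ⟨p, mem_filter.2 ⟨mem_univ _, (admissible_iff_isChain p).2 (by rwa [hp])⟩, hp⟩

/-- The generating function of `G`, modulo `q ^ M`. -/
theorem sum_G_mul_pow {q : R} {M : ℕ} (hM : q ^ M = 0) {v : ℕ → R}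
    (hv : IsInvPochhammer (q ^ 4) v) :
    ∑ N ∈ range M, (G N : R) * q ^ N =
      ∑ n ∈ range M, q ^ (n ^ 2 + 2 * n) * oddProd q n * v n := by
  set U := (range M).biUnion fun n => gapLists M n 0 with hU
  have h1 : ∑ N ∈ range M, (G N : R) * q ^ N = ∑ l ∈ U with l.sum < M, q ^ l.sum := by
    rw [← sum_fiberwise_of_maps_to (t := range M) (g := List.sum) (by simp)]
    refine sum_congr rfl fun N hN => ?_
    rw [mem_range] at hN
    rw [G_eq_card_gapLists hN, ← hU, ← nsmul_eq_mul, ← sum_const, filter_filter]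
    refine sum_congr (filter_congr fun l _ => by omega) fun l hl => ?_
    rw [(mem_filter.1 hl).2.2]
  rw [h1, sum_filter_of_ne, hU, sum_biUnion]
  · refine sum_congr rfl fun n _ => ?_
    rw [sum_gapLists_eq hM hv]
    ring
  · intro m _ n _ hmn
    rw [Function.onFun, disjoint_left]
    intro l hl hl'
    exact hmn ((mem_gapLists.1 hl).1.symm.trans (mem_gapLists.1 hl').1)
  · intro l _ hl
    by_contra hcon
    exact hl (pow_eq_zero_of_ge hM (not_lt.1 hcon))

end Chains

/-! ### The generating function of `P`. -/

section PartGenFun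

open PowerSeries
open scoped PowerSeries.WithPiTopology

/-- The weight of a part `i` occurring `c` times in a partition counted by `P`. -/
def partWeight (i c : ℕ) : ℤ :=
  if i % 12 = 4 ∨ i % 12 = 8 then 1 else if i % 6 = 3 ∧ c ≤ 1 then 1 else 0

theorem P_eq_sum (N : ℕ) : (P N : ℤ) = ∑ p : N.Partition, p.parts.toFinsupp.prod partWeight := by
  classical
  rw [P, card_filter, Nat.cast_sum]
  refine sum_congr rfl fun p _ => ?_
  have hw : ∀ a ∈ p.parts.toFinsupp.support, partWeight a (p.parts.toFinsupp a) =
      if (a % 12 = 4 ∨ a % 12 = 8) ∨ (a % 6 = 3 ∧ p.parts.count a ≤ 1) then 1 else 0 := by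
    intro a _
    rw [Multiset.toFinsupp_apply, partWeight]
    split_ifs <;> tauto
  rw [Finsupp.prod, prod_congr rfl hw, prod_boole, Nat.cast_ite, Nat.cast_one, Nat.cast_zero]
  refine if_congr ?_ rfl rfl
  simp only [PartsModTwelve, DistinctThreeModSix, Multiset.toFinsupp_support,
    Multiset.mem_toFinset, ← forall₂_and]
  refine forall₂_congr fun a _ => ?_
  simp only [Int.ModEq, Nat.ModEq]
  generalize p.parts.count a = c
  by_cases hc : c ≤ 1 <;> simp only [hc, imp_true_iff, imp_false, and_true, and_false, or_false] <;>
    omega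

/-- Clears the denominator of the geometric series for parts ≡ ±4 modulo 12. -/
theorem one_add_tsum_partWeight (i : ℕ) :
    (1 + ∑' j, partWeight (i + 1) (j + 1) • (X : ℤ⟦X⟧) ^ ((i + 1) * (j + 1))) *
      (if (i + 1) % 12 = 4 ∨ (i + 1) % 12 = 8 then 1 - X ^ (i + 1) else 1) =
    if (i + 1) % 6 = 3 then 1 + X ^ (i + 1) else 1 := by
  by_cases h : (i + 1) % 12 = 4 ∨ (i + 1) % 12 = 8
  · have h3 : ¬ (i + 1) % 6 = 3 := by omega
    have hX : constantCoeff ((X : ℤ⟦X⟧) ^ (i + 1)) = 0 := by simp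
    have hsum : Summable fun j => ((X : ℤ⟦X⟧) ^ (i + 1)) ^ j :=
      WithPiTopology.summable_pow_of_constantCoeff_eq_zero hX
    simp only [partWeight, h, h3, if_true, if_false, one_smul, pow_mul]
    refine Eq.trans ?_ (WithPiTopology.tsum_pow_mul_one_sub_of_constantCoeff_eq_zero hX)
    rw [hsum.tsum_eq_zero_add, pow_zero]
  · simp only [partWeight, h, if_false, mul_one]
    split_ifs with h3
    · rw [tsum_eq_single 0 fun j hj => by simp [hj]]
      simp [h3]
    · simp [h3]

/-- The generating function of `P`, modulo `q ^ M`. -/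
theorem sum_P_mul_pow {R : Type*} [CommRing R] (φ : ℤ⟦X⟧ →+* R) {M : ℕ} (hM : φ X ^ M = 0) :
    (∑ N ∈ range M, (P N : R) * φ X ^ N) *
      (residueProd (φ X) M 12 4 * residueProd (φ X) M 12 8) =
    ∏ i ∈ range M, if (i + 1) % 6 = 3 % 6 then 1 + φ X ^ (i + 1) else 1 := by
  -- Since φ kills X^M, it sees only the coefficients below degree M.
  have hφ {f g : ℤ⟦X⟧} (h : ∀ d < M, coeff d f = coeff d g) : φ f = φ g := by
    obtain ⟨k, hk⟩ := X_pow_dvd_iff.2 (fun d hd => by rw [map_sub, h d hd, sub_self] :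
      ∀ d < M, coeff d (f - g) = 0)
    rw [← sub_eq_zero, ← map_sub, hk, map_mul, map_pow, hM, zero_mul]
  have hgen := Nat.Partition.hasProd_genFun partWeight
  rw [HasProd, WithPiTopology.tendsto_iff_coeff_tendsto] at hgen
  -- ℤ is discrete, so each coefficient of the partial products is eventually constant; one finite s
  -- serves all degrees below M.
  have hev : ∀ᶠ s : Finset ℕ in Filter.atTop, range M ⊆ s ∧ ∀ d ∈ range M,
      coeff d (∏ i ∈ s, (1 + ∑' j, partWeight (i + 1) (j + 1) • (X : ℤ⟦X⟧) ^ ((i + 1) * (j + 1)))) =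
      coeff d (Nat.Partition.genFun partWeight) := by
    refine (Filter.eventually_ge_atTop _).and ((Filter.eventually_all_finset _).2 fun d _ => ?_)
    have h := hgen d
    rw [nhds_discrete, Filter.tendsto_pure] at h
    exact h
  obtain ⟨s, hs, hcoeff⟩ := hev.exists
  have h1 : ∑ N ∈ range M, (P N : R) * φ X ^ N = φ (Nat.Partition.genFun partWeight) := by
    have : ∑ N ∈ range M, (P N : R) * φ X ^ N =
        φ (∑ N ∈ range M, ((P N : ℤ) : ℤ⟦X⟧) * X ^ N) := by simp
    rw [this]
    refine hφ fun d hd => ?_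
    rw [Nat.Partition.coeff_genFun, ← P_eq_sum, map_sum, sum_eq_single d]
    · rw [← eq_intCast (C (R := ℤ)), coeff_C_mul, coeff_X_pow_self, mul_one]
    · intro b _ hb
      rw [← eq_intCast (C (R := ℤ)), coeff_C_mul, coeff_X_pow, if_neg hb.symm, mul_zero]
    · simp [hd]
  have h2 : residueProd (φ X) M 12 4 * residueProd (φ X) M 12 8 = φ (∏ i ∈ s,
      if (i + 1) % 12 = 4 ∨ (i + 1) % 12 = 8 then 1 - X ^ (i + 1) else 1) := by
    rw [map_prod, residueProd, residueProd, ← prod_mul_distrib]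
    refine (prod_congr rfl fun i _ => ?_).trans (prod_subset hs fun i _ hi => ?_)
    · split_ifs <;> first | omega | simp
    · rw [apply_ite φ, map_one, map_sub, map_one, map_pow,
        pow_eq_zero_of_ge hM (by have := mt mem_range.2 hi; omega), sub_zero, ite_self]
  rw [h1, ← hφ fun d hd => hcoeff d (mem_range.2 hd), h2, ← map_mul, ← prod_mul_distrib, map_prod]
  simp only [one_add_tsum_partWeight]
  symm
  refine (prod_congr rfl fun i _ => ?_).trans (prod_subset hs fun i _ hi => ?_)
  · split_ifs <;> simp
  · rw [apply_ite φ, map_one, map_add, map_one, map_pow,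
      pow_eq_zero_of_ge hM (by have := mt mem_range.2 hi; omega), add_zero, ite_self]

end PartGenFun

end GapPartition

theorem theorem5 (N : ℕ) : GapPartition.G N = GapPartition.P N := by
  set I : Ideal (PowerSeries ℤ) := Ideal.span {PowerSeries.X ^ (N + 1)} with hI
  set φ := Ideal.Quotient.mk I with hφ
  have hM : φ PowerSeries.X ^ (N + 1) = 0 := by
    rw [← map_pow, Ideal.Quotient.eq_zero_iff_mem]
    exact Ideal.mem_span_singleton_self _
  obtain ⟨v, hv⟩ := GapPartition.exists_isInvPochhammer hM (c := 4) (by norm_num)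
  have h : ∑ k ∈ range (N + 1), (GapPartition.G k : PowerSeries ℤ ⧸ I) * φ PowerSeries.X ^ k =
      ∑ k ∈ range (N + 1), (GapPartition.P k : PowerSeries ℤ ⧸ I) * φ PowerSeries.X ^ k := by
    refine ((GapPartition.isUnit_residueProd hM 12 4).mul
      (GapPartition.isUnit_residueProd hM 12 8)).mul_right_cancel ?_
    rw [GapPartition.sum_P_mul_pow φ hM, GapPartition.sum_G_mul_pow hM hv,
      GapPartition.sum_gap_mul_eq_prod hM hv]
  -- Lifted to ℤ⟦X⟧, the difference is divisible by X^(N+1), so its coefficient at X^N is zero.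
  have h' : φ (∑ k ∈ range (N + 1), ((GapPartition.G k : ℤ) - (GapPartition.P k : ℤ) : ℤ) •
      PowerSeries.X ^ k) = 0 := by
    rw [← sub_eq_zero, ← sum_sub_distrib] at h
    rw [map_sum, ← h]
    refine sum_congr rfl fun k _ => ?_
    rw [map_zsmul, map_pow, zsmul_eq_mul]
    push_cast
    ring
  rw [Ideal.Quotient.eq_zero_iff_mem, hI, Ideal.mem_span_singleton, PowerSeries.X_pow_dvd_iff] at h'
  have hN := h' N N.lt_succ_self
  rw [map_sum, sum_eq_single N] at hN
  · rw [map_zsmul, PowerSeries.coeff_X_pow_self, smul_eq_mul, mul_one, sub_eq_zero] at hN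
    exact_mod_cast hN
  · intro k _ hk
    rw [map_zsmul, PowerSeries.coeff_X_pow, if_neg hk.symm, smul_zero]
  · simp
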